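/- Theorem (SCSS with bounded cycle length). All graphs are finite. A digraph is symmetric if $(v,u)$ is an arc whenever $(u,v)$ is. A cycle is a simple directed cycle with at least two nodes, and its length is its number of arcs. A strongly connected spanning subgraph (SCSS) of a digraph is a set of its arcs by which every node reaches every node. The cycle contraction algorithm of Khuller et al. with threshold $t$ works as follows on a strongly connected digraph $G$. While the current digraph has a cycle of length at least $t$, choose any such cycle, record its arcs and contract it to a single node. Once there is no such cycle, and as long as the current digraph has a cycle of length greater than $3$, choose a longest cycle, record its arcs and contract it. When the current digraph has no cycle of length at least $t$ and none of length greater than $3$, find a minimum-size SCSS of it, and return its arcs together with all recorded arcs. (Arcs of contracted digraphs are represented by arcs of $G$; arcs inside a contracted set disappear.) Let $G$ be a symmetric, unweighted, strongly connected digraph whose maximum cycle length is $k$, and let $t\ge k$ (so that every contracted cycle of length greater than $3$ is a longest cycle of the current digraph). Assume that $k<24$ or that the following conjecture holds. Conjecture (second Hamiltonian cycle). Let $H$ be a Hamiltonian cycle (a simple undirected cycle) on a set of nodes $V$, and let $G_b=(V,U,E)$ be a connected bipartite graph with sides $V$ and $U$. Then the graph $(V\cup U,\,H\cup E)$ contains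 a simple cycle with node set exactly $V$ and a simple cycle whose node set contains $V$, such that these two cycles differ in at least one edge. Then the algorithm with threshold $t$ is a $\frac{3k-2}{2k}$-approximation algorithm for the minimum SCSS problem on $G$: whatever choices it makes, it halts, and each set $R$ that it can return is an SCSS of $G$ with $$|R|\le \frac{3k-2}{2k}\,|T|\qquad\text{for every SCSS } T \text{ of } G,$$ that is, $|R|\le\frac{3k-2}{2k}\cdot OPT(G)$. -/

import Mathlib

namespace SCSS

/-! ### Second Hamiltonian cycles with respect to a set of nodes -/

/-- `G` contains a second `Γ`-Hamiltonian cycle: there are a simple cycle `p` whose nodes are exactly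
the nodes of `Γ` and a simple cycle `q` whose nodes include all the nodes of `Γ`, and these two
cycles differ in at least one edge. -/
def HasSecHamCycle {W : Type*} (G : SimpleGraph W) (Γ : Set W) : Prop :=
  ∃ (a b : W) (p : G.Walk a a) (q : G.Walk b b),
    p.IsCycle ∧ q.IsCycle ∧ {x | x ∈ p.support} = Γ ∧ Γ ⊆ {x | x ∈ q.support} ∧
      p.edgeSet ≠ q.edgeSet

/-- The second Hamiltonian cycle conjecture: if `h` is a Hamiltonian cycle on a set of nodes `Γ`, then
for every connected bipartite graph `B` with sides `Γ` and `Γᶜ`, the graph whose edges are those of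
`h` and those of `B` contains a second `Γ`-Hamiltonian cycle. -/
def SecondHamCycleConjecture : Prop :=
  ∀ (W : Type) [Finite W] (Γ : Set W) (a : W) (h : (⊤ : SimpleGraph W).Walk a a)
    (B : SimpleGraph W),
    h.IsCycle → {x | x ∈ h.support} = Γ → B.IsBipartiteWith Γ Γᶜ → B.Connected →
      HasSecHamCycle (SimpleGraph.fromEdgeSet h.edgeSet ⊔ B) Γ

/-! ### Strongly connected spanning subgraphs -/

/-- Every node can be reached from every node by a directed path. -/
def StronglyConnected {W : Type*} (D : Digraph W) : Prop :=
  ∀ u v : W, Relation.ReflTransGen D.Adj u v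

/-- The digraph with arc set `T`. -/
def ofArcs {W : Type*} (T : Set (W × W)) : Digraph W where
  Adj u v := (u, v) ∈ T

/-- `T` is the arc set of a strongly connected spanning subgraph of `D`. -/
def IsSCSS {W : Type*} (D : Digraph W) (T : Set (W × W)) : Prop :=
  (∀ e ∈ T, D.Adj e.1 e.2) ∧ StronglyConnected (ofArcs T)

/-- A strongly connected spanning subgraph with the minimum number of arcs. -/
def IsMinSCSS {W : Type*} (D : Digraph W) (T : Set (W × W)) : Prop :=
  IsSCSS D T ∧ ∀ T', IsSCSS D T' → T.ncard ≤ T'.ncard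

/-- `c` runs through a simple directed cycle of length `l` (with `l` nodes and `l` arcs). -/
def IsDicycle {W : Type*} (D : Digraph W) (l : ℕ) (c : ZMod l → W) : Prop :=
  2 ≤ l ∧ Function.Injective c ∧ ∀ i, D.Adj (c i) (c (i + 1))

/-- The set of the lengths of the simple directed cycles of `D`. -/
def cycleLengths {W : Type*} (D : Digraph W) : Set ℕ :=
  {l | ∃ c : ZMod l → W, IsDicycle D l c}

/-! ### The cycle contraction algorithm -/

/-- The digraph obtained from `G` by contracting each class of `r` to a single node
(arcs inside a class disappear). -/
def contract {V : Type*} (G : Digraph V) (r : Setoid V) : Digraph (Quotient r) where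
  Adj a b := a ≠ b ∧ ∃ u v : V, Quotient.mk r u = a ∧ Quotient.mk r v = b ∧ G.Adj u v

/-- The partition obtained from that of `r` by merging all the classes in `C` into one. -/
def mergeClasses {V : Type*} (r : Setoid V) (C : Set (Quotient r)) : Setoid V where
  r u v := Quotient.mk r u = Quotient.mk r v ∨ (Quotient.mk r u ∈ C ∧ Quotient.mk r v ∈ C)
  iseqv :=
    { refl := fun _ => Or.inl rfl
      symm := by
        rintro u v (h | ⟨h, h'⟩)
        · exact Or.inl h.symm
        · exact Or.inr ⟨h', h⟩
      trans := by
        rintro u v w (h | ⟨h, h'⟩) (k | ⟨k, k'⟩)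
        · exact Or.inl (h.trans k)
        · exact Or.inr ⟨h ▸ k, k'⟩
        · exact Or.inr ⟨h, k ▸ h'⟩
        · exact Or.inr ⟨h, k'⟩ }

/-- A state of the algorithm: the current contracted digraph is `contract G rel`, and `arcs` holds the
arcs of the input digraph contracted so far. -/
structure State (V : Type*) where
  rel : Setoid V
  arcs : Set (V × V)

/-- Nothing is contracted yet. -/
def State.init (V : Type*) : State V where
  rel := ⊥
  arcs := ∅

/-- The algorithm with threshold `t` may contract a cycle of length `l` in the current digraph `D`:
any cycle of length at least `t` and, once there is none, a longest cycle, if it is longer than `3`. -/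
def MayContract {W : Type*} (D : Digraph W) (t l : ℕ) : Prop :=
  t ≤ l ∨ ((∀ m ∈ cycleLengths D, m < t) ∧ (∀ m ∈ cycleLengths D, m ≤ l) ∧ 4 ≤ l)

/-- One contraction: a cycle `c` of the current digraph is chosen, each arc of `c` is represented by an
arc `e i` of the input digraph `G`, these arcs are recorded, and the nodes of `c` are merged. -/
def Step {V : Type*} (G : Digraph V) (t : ℕ) (s s' : State V) : Prop :=
  ∃ (l : ℕ) (c : ZMod l → Quotient s.rel) (e : ZMod l → V × V),
    IsDicycle (contract G s.rel) l c ∧ MayContract (contract G s.rel) t l ∧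
    (∀ i, G.Adj (e i).1 (e i).2 ∧
      Quotient.mk s.rel (e i).1 = c i ∧ Quotient.mk s.rel (e i).2 = c (i + 1)) ∧
    s' = ⟨mergeClasses s.rel (Set.range c), s.arcs ∪ Set.range e⟩

/-- The last step: the current digraph has no cycle of length at least `t` and no cycle of length greater
than `3`; an optimal solution `T₀` of it is found, its arcs are represented by arcs `T` of the
input digraph `G`, and `R`, all the arcs recorded so far together with `T`, is returned. -/
def Finish {V : Type*} (G : Digraph V) (t : ℕ) (s : State V) (R : Set (V × V)) : Prop :=
  (∀ m ∈ cycleLengths (contract G s.rel), m < t ∧ m ≤ 3) ∧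
  ∃ (T₀ : Set (Quotient s.rel × Quotient s.rel)) (T : Set (V × V)),
    IsMinSCSS (contract G s.rel) T₀ ∧ (∀ e ∈ T, G.Adj e.1 e.2) ∧
    Set.BijOn (fun e : V × V => (Quotient.mk s.rel e.1, Quotient.mk s.rel e.2)) T T₀ ∧
    R = s.arcs ∪ T

/-- `s` occurs in some run of the algorithm on input `G`. -/
def Reachable {V : Type*} (G : Digraph V) (t : ℕ) (s : State V) : Prop :=
  Relation.ReflTransGen (Step G t) (State.init V) s

/-- `R` is returned by some run of the algorithm on input `G`. -/
def IsOutput {V : Type*} (G : Digraph V) (t : ℕ) (R : Set (V × V)) : Prop :=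
  ∃ s, Reachable G t s ∧ Finish G t s R

/-- Every run of the algorithm on input `G`, whatever choices it makes, halts and returns something:
there is no infinite sequence of contractions, and no run gets stuck. -/
def AlwaysHalts {V : Type*} (G : Digraph V) (t : ℕ) : Prop :=
  Acc (fun s' s => Step G t s s') (State.init V) ∧
  ∀ s, Reachable G t s → (∃ s', Step G t s s') ∨ ∃ R, Finish G t s R

end SCSS

namespace SCSS

open Relation

/-! ### Lists and directed cycles -/

/-! Let `G` have n nodes. Contracting a cycle of length l records l arcs and removes l - 1 nodes, so
N contractions that leave q nodes record n - q + N arcs. The final optimum has at most 2(q - 1)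
arcs. If k ≥ 3 it also has at most |T| - 2N arcs, because each contraction destroys at least two
arcs of `T`. Averaging the two bounds gives 2|R| ≤ 2(n - 1) + |T| (`Finish.two_mul_ncard_le`).
Contracting `T` itself to a point gives k(n - 1) ≤ (k - 1)|T| (`IsSCSS.le_ncard`), and the ratio
follows.

The heart is `IsSCSS.two_le_ncard_inter`. Let Γ be the node set of a longest cycle and B the graph
of the edges of `T` not inside Γ. If B is disconnected, `T` must leave and enter a component, and
does so inside Γ. If B is connected, it has a subgraph whose degrees are odd on Γ, except perhaps at
one node, and even elsewhere. Add this subgraph to the cycle: the lollipop parity argument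
(`exists_isCoverPath_ne`) yields a second cycle covering Γ. Being no longer than the first, it stays
in Γ, where only edges of the first cycle are available: a contradiction. -/

theorem exists_nodup_isChain {α : Type*} {r : α → α → Prop} {a b : α} (h : ReflTransGen r a b) :
    ∃ L : List α, L.Nodup ∧ L.IsChain r ∧ L.head? = some a ∧ L.getLast? = some b := by
  induction h using ReflTransGen.head_induction_on with
  | refl => exact ⟨[b], by simp⟩
  | @head a c hac _ ih =>
    obtain ⟨L, hn, hc, hh, hl⟩ := ih
    by_cases ha : a ∈ L
    · obtain ⟨s, t, rfl⟩ := List.append_of_mem ha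
      refine ⟨a :: t, (List.nodup_append.1 hn).2.1, hc.right_of_append, rfl, ?_⟩
      simpa [List.getLast?_append] using hl
    · refine ⟨a :: L, List.nodup_cons.2 ⟨ha, hn⟩, hc.cons ?_, rfl, ?_⟩
      · intro y hy
        rw [hh] at hy
        cases hy
        exact hac
      · cases L with
        | nil => simp at hh
        | cons x L => simpa [List.getLast?_cons_cons] using hl

theorem natCast_zmod_inj_of_lt {l i j : ℕ} (hi : i < l) (hj : j < l) (h : (i : ZMod l) = j) :
    i = j := by
  rw [ZMod.natCast_eq_natCast_iff'] at h
  rwa [Nat.mod_eq_of_lt hi, Nat.mod_eq_of_lt hj] at h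

/-- Cycles arise below as lists, by concatenation and exchange; this is the passage to the cyclic
indexing of `IsDicycle`. -/
theorem length_mem_cycleLengths {W : Type*} {D : Digraph W} {L : List W} (hn : L.Nodup)
    (h2 : 2 ≤ L.length) (hc : L.IsChain D.Adj)
    (hcl : ∀ a b, L.getLast? = some a → L.head? = some b → D.Adj a b) :
    L.length ∈ cycleLengths D := by
  have : NeZero L.length := ⟨by lia⟩
  have : Fact (1 < L.length) := ⟨by lia⟩
  refine ⟨fun i => L[i.val]'(ZMod.val_lt i), h2, ?_, ?_⟩
  · intro i j hij
    exact ZMod.val_injective _ ((hn.getElem_inj_iff).1 hij)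
  · intro i
    have hi := ZMod.val_lt i
    by_cases h : i.val + 1 < L.length
    · have h1 : (i + 1).val = i.val + 1 := by
        rw [ZMod.val_add, ZMod.val_one, Nat.mod_eq_of_lt h]
      simp only [h1]
      exact hc.getElem _ h
    · have h0 : (i + 1).val = 0 := by
        rw [ZMod.val_add, ZMod.val_one, show i.val + 1 = L.length by lia, Nat.mod_self]
      simp only [h0]
      apply hcl
      · rw [List.getLast?_eq_getElem?, List.getElem?_eq_getElem (by lia)]
        simp only [Option.some.injEq]
        congr 1
        lia
      · rw [List.head?_eq_getElem?, List.getElem?_eq_getElem (by lia)]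

/-- Within each class on the cycle, the head of the entering arc is joined to the tail of the
leaving arc by a simple path. Classes are disjoint, so these paths concatenate to a simple cycle
with at least one node per class. -/
theorem exists_le_mem_cycleLengths_of_contract {V : Type*} {G : Digraph V} {r : Setoid V}
    (hr : ∀ u v : V, Quotient.mk r u = Quotient.mk r v →
      ReflTransGen (fun a b => G.Adj a b ∧ Quotient.mk r a = Quotient.mk r b) u v)
    {l : ℕ} (hl : l ∈ cycleLengths (contract G r)) : ∃ m ∈ cycleLengths G, l ≤ m := by
  obtain ⟨c, h2, hinj, hadj⟩ := hl
  choose hne a b ha hb hab using hadj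
  have hP : ∀ j : ZMod l, ∃ L : List V, L.Nodup ∧ L.IsChain G.Adj ∧ L.head? = some (b (j - 1)) ∧
      L.getLast? = some (a j) ∧ ∀ x ∈ L, Quotient.mk r x = c j := by
    intro j
    have hbj : Quotient.mk r (b (j - 1)) = c j := by rw [hb]; simp
    obtain ⟨L, hn, hc, hh, hlast⟩ := exists_nodup_isChain (hr (b (j - 1)) (a j) (by rw [hbj, ha]))
    refine ⟨L, hn, hc.imp fun _ _ h => h.1, hh, hlast, ?_⟩
    cases L with
    | nil => simp at hh
    | cons y L =>
      simp only [List.head?_cons, Option.some.injEq] at hh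
      subst hh
      have : (b (j - 1) :: L).IsChain fun x y => Quotient.mk r x = Quotient.mk r y :=
        hc.imp fun _ _ h => h.2
      have htr : Trans (fun x y : V => Quotient.mk r x = Quotient.mk r y)
        (fun x y : V => Quotient.mk r x = Quotient.mk r y)
        (fun x y : V => Quotient.mk r x = Quotient.mk r y) := ⟨fun h h' => h.trans h'⟩
      have hp := List.isChain_iff_pairwise.1 this
      intro x hx
      rcases List.mem_cons.1 hx with rfl | hx
      · exact hbj
      · rw [← (List.pairwise_cons.1 hp).1 x hx, hbj]
  choose P hPn hPc hPh hPl hPm using hP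
  have hPne : ∀ j, P j ≠ [] := fun j h => by simpa [h] using hPh j
  obtain ⟨l, rfl⟩ : ∃ l', l = l' + 1 := ⟨l - 1, by lia⟩
  set LL : List (List V) := (List.range (l + 1)).map fun j : ℕ => P (j : ZMod (l + 1)) with hLL
  have hlen : l + 1 ≤ LL.flatten.length := by
    have h := List.card_nsmul_le_sum (LL.map List.length) 1 (by
      simp only [hLL, List.mem_map]
      rintro _ ⟨_, ⟨j, _, rfl⟩, rfl⟩
      exact List.length_pos_of_ne_nil (hPne _))
    rw [List.length_flatten]
    simpa [hLL] using h
  refine ⟨LL.flatten.length, length_mem_cycleLengths ?_ ?_ ?_ ?_, ?_⟩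
  · rw [List.nodup_flatten]
    constructor
    · simp only [hLL, List.mem_map]
      rintro _ ⟨j, _, rfl⟩
      exact hPn _
    · rw [hLL, List.pairwise_map]
      refine List.Pairwise.imp_of_mem ?_ (List.nodup_range (n := l + 1))
      intro i j hi hj hij x hx hy
      refine hij (natCast_zmod_inj_of_lt (List.mem_range.1 hi) (List.mem_range.1 hj) (hinj ?_))
      rw [← hPm _ x hx, ← hPm _ x hy]
  · exact h2.trans hlen
  · rw [List.isChain_flatten]
    · constructor
      · simp only [hLL, List.mem_map]
        rintro _ ⟨j, _, rfl⟩
        exact hPc _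
      · rw [hLL, List.isChain_map, List.isChain_iff_getElem]
        intro i hi x hx y hy
        simp only [List.getElem_range, hPl, hPh, Option.mem_def, Option.some.injEq] at hx hy
        subst hx hy
        simpa using hab i
    · simp only [hLL, List.mem_map]
      rintro ⟨j, _, hj⟩
      exact hPne _ hj
  · intro x y hx hy
    have hx' : a (l : ZMod (l + 1)) = x := by
      rw [hLL, List.range_succ] at hx
      simpa [List.getLast?_append, hPl] using hx
    have hy' : b ((0 : ZMod (l + 1)) - 1) = y := by
      rw [hLL, List.range_succ_eq_map] at hy
      simpa [List.head?_append, hPh] using hy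
    -- The closing arc runs from the last class, of index `l`, to the class of index 0.
    have h0 : (0 : ZMod (l + 1)) - 1 = l := by
      have : ((l + 1 : ℕ) : ZMod (l + 1)) = 0 := ZMod.natCast_self _
      push_cast at this
      linear_combination -this
    rw [← hx', ← hy', h0]
    exact hab _
  · exact hlen

/-! ### Runs of the algorithm -/

/-- `s` is the outcome of `N` contractions of cycles of `G`. -/
structure IsContraction {V : Type*} (G : Digraph V) (s : State V) (N : ℕ) : Prop where
  adj : ∀ e ∈ s.arcs, G.Adj e.1 e.2
  mk_eq : ∀ e ∈ s.arcs, Quotient.mk s.rel e.1 = Quotient.mk s.rel e.2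
  reach : ∀ u v : V, Quotient.mk s.rel u = Quotient.mk s.rel v →
    ReflTransGen (ofArcs s.arcs).Adj u v
  -- A cycle of length l trades l - 1 nodes for l arcs, so arcs plus nodes grow by one per
  -- contraction. The next two fields express 1 ≤ l - 1 ≤ k - 1.
  card : s.arcs.ncard + Nat.card (Quotient s.rel) = Nat.card V + N
  card_le : N + Nat.card (Quotient s.rel) ≤ Nat.card V
  le_card : ∀ k, (∀ m ∈ cycleLengths G, m ≤ k) →
    Nat.card V ≤ Nat.card (Quotient s.rel) + N * (k - 1)

theorem IsContraction.init {V : Type*} (G : Digraph V) : IsContraction G (State.init V) 0 := by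
  have h : Nat.card (Quotient (State.init V).rel) = Nat.card V := by
    refine (Nat.card_congr (Equiv.ofBijective (Quotient.mk (State.init V).rel) ⟨?_, ?_⟩)).symm
    · intro u v huv
      exact Quotient.exact huv
    · exact Quotient.mk_surjective
  refine ⟨fun e he => he.elim, fun e he => he.elim, ?_, ?_, ?_, ?_⟩
  · intro u v huv
    have : u = v := Quotient.exact huv
    rw [this]
  · simp [State.init] at h ⊢
    simp [h]
  · rw [h]; simp
  · intro k _
    rw [h]
    simp

theorem IsContraction.exists_le_mem_cycleLengths {V : Type*} {G : Digraph V} {s : State V} {N : ℕ}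
    (h : IsContraction G s N) {l : ℕ} (hl : l ∈ cycleLengths (contract G s.rel)) :
    ∃ m ∈ cycleLengths G, l ≤ m :=
  exists_le_mem_cycleLengths_of_contract (fun u v huv =>
    ReflTransGen.mono (fun a b hab => ⟨h.adj (a, b) hab, h.mk_eq (a, b) hab⟩) _ _
      (h.reach u v huv)) hl

theorem mk_mergeClasses_eq_iff {V : Type*} {r : Setoid V} {C : Set (Quotient r)} {u v : V} :
    Quotient.mk (mergeClasses r C) u = Quotient.mk (mergeClasses r C) v ↔
      Quotient.mk r u = Quotient.mk r v ∨ (Quotient.mk r u ∈ C ∧ Quotient.mk r v ∈ C) :=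
  Quotient.eq

theorem card_quotient_mergeClasses {V : Type*} [Finite V] {r : Setoid V} {C : Set (Quotient r)}
    (hC : C.Nonempty) :
    Nat.card (Quotient (mergeClasses r C)) + C.ncard = Nat.card (Quotient r) + 1 := by
  let f : Quotient r → Quotient (mergeClasses r C) :=
    Quotient.map' id fun u v huv => Or.inl (Quotient.sound huv)
  have hf : ∀ u, f (Quotient.mk r u) = Quotient.mk _ u := fun u => rfl
  have hfe : ∀ a b, f a = f b ↔ a = b ∨ (a ∈ C ∧ b ∈ C) := by
    intro a b
    induction a using Quotient.inductionOn
    induction b using Quotient.inductionOn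
    rw [hf, hf]
    exact mk_mergeClasses_eq_iff
  obtain ⟨c, hc⟩ := hC
  -- One new class for all of `C`, and one for each class outside `C`.
  have huniv : (Set.univ : Set (Quotient (mergeClasses r C))) = insert (f c) (f '' Cᶜ) := by
    refine (Set.eq_univ_of_forall fun x => ?_).symm
    induction x using Quotient.inductionOn with
    | _ u =>
      by_cases hu : Quotient.mk r u ∈ C
      · left
        rw [← hf, hfe]
        exact Or.inr ⟨hu, hc⟩
      · right
        exact ⟨_, hu, hf u⟩
  have hnot : f c ∉ f '' Cᶜ := by
    rintro ⟨a, ha, hac⟩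
    rcases (hfe a c).1 hac with rfl | h
    · exact ha hc
    · exact ha h.1
  have hinj : Set.InjOn f Cᶜ := by
    intro a ha b hb hab
    rcases (hfe a b).1 hab with h | h
    · exact h
    · exact (ha h.1).elim
  rw [← Set.ncard_univ, huniv, Set.ncard_insert_of_notMem hnot, hinj.ncard_image,
    ← Set.ncard_add_ncard_compl C]
  ring

theorem ncard_range_of_dicycle {W : Type*} {D : Digraph W} {l : ℕ} {c : ZMod l → W}
    (hc : IsDicycle D l c) : (Set.range c).ncard = l := by
  rw [Set.ncard_range_of_injective hc.2.1, Nat.card_zmod]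

theorem IsContraction.step {V : Type*} [Finite V] {G : Digraph V} {t : ℕ} {s s' : State V} {N : ℕ}
    (h : IsContraction G s N) (hs : Step G t s s') : IsContraction G s' (N + 1) := by
  obtain ⟨l, c, e, hc, -, he, rfl⟩ := hs
  have hl2 := hc.1
  have : NeZero l := ⟨by lia⟩
  have : Fact (1 < l) := ⟨by lia⟩
  have heinj : Function.Injective e := by
    intro i j hij
    apply hc.2.1
    rw [← (he i).2.1, hij, (he j).2.1]
  -- Recorded arcs lie inside classes, while the new ones join distinct classes.
  have hdisj : Disjoint s.arcs (Set.range e) := by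
    rw [Set.disjoint_left]
    rintro _ hi ⟨i, rfl⟩
    have := h.mk_eq _ hi
    rw [(he i).2.1, (he i).2.2] at this
    have := hc.2.1 this
    simp at this
  have hcard : (s.arcs ∪ Set.range e).ncard = s.arcs.ncard + l := by
    rw [Set.ncard_union_eq hdisj, Set.ncard_range_of_injective heinj, Nat.card_zmod]
  have hq := card_quotient_mergeClasses (r := s.rel) (C := Set.range c) ⟨c 0, 0, rfl⟩
  rw [ncard_range_of_dicycle hc] at hq
  have hold : ∀ {u v : V}, Quotient.mk s.rel u = Quotient.mk s.rel v →
      ReflTransGen (ofArcs (s.arcs ∪ Set.range e)).Adj u v := fun huv =>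
    ReflTransGen.mono (fun a b hab => Or.inl hab) _ _ (h.reach _ _ huv)
  -- Follow `n` arcs of the cycle, linking consecutive representatives inside their common class by
  -- older arcs.
  have hwalk : ∀ (n : ℕ) (i : ZMod l) (u v : V), Quotient.mk s.rel u = c i →
      Quotient.mk s.rel v = c (i + n) → ReflTransGen (ofArcs (s.arcs ∪ Set.range e)).Adj u v := by
    intro n i u
    induction n with
    | zero =>
      intro v hu hv
      exact hold (by simpa [hu] using hv.symm)
    | succ n ih =>
      intro v hu hv
      have h1 := ih (e (i + n)).1 hu (he _).2.1
      have h2 : (ofArcs (s.arcs ∪ Set.range e)).Adj (e (i + n)).1 (e (i + n)).2 :=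
        Or.inr ⟨i + n, rfl⟩
      refine (h1.tail h2).trans (hold ?_)
      rw [(he _).2.2, hv]
      push_cast
      rw [add_assoc]
  refine ⟨?_, ?_, ?_, ?_, ?_, ?_⟩
  · rintro a (ha | ⟨i, rfl⟩)
    · exact h.adj a ha
    · exact (he i).1
  · rintro a (ha | ⟨i, rfl⟩)
    · exact mk_mergeClasses_eq_iff.2 (Or.inl (h.mk_eq a ha))
    · exact mk_mergeClasses_eq_iff.2 (Or.inr ⟨⟨i, (he i).2.1.symm⟩, ⟨i + 1, (he i).2.2.symm⟩⟩)
  · intro u v huv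
    rcases mk_mergeClasses_eq_iff.1 huv with huv | ⟨⟨i, hi⟩, ⟨j, hj⟩⟩
    · exact hold huv
    · refine hwalk (j - i).val i u v hi.symm ?_
      rw [ZMod.natCast_zmod_val, ← hj]
      simp
  · have := h.card
    simp only
    rw [hcard]
    lia
  · have := h.card_le
    simp only
    lia
  · intro k hk
    have h1 := h.le_card k hk
    obtain ⟨m, hm, hlm⟩ := h.exists_le_mem_cycleLengths ⟨c, hc⟩
    have h2 := hk m hm
    simp only
    rw [add_mul]
    lia

theorem Reachable.exists_isContraction {V : Type*} [Finite V] {G : Digraph V} {t : ℕ} {s : State V}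
    (h : Reachable G t s) : ∃ N, IsContraction G s N := by
  induction h with
  | refl => exact ⟨0, IsContraction.init G⟩
  | tail _ hs ih =>
    obtain ⟨N, hN⟩ := ih
    exact ⟨N + 1, hN.step hs⟩

theorem Step.card_lt {V : Type*} [Finite V] {G : Digraph V} {t : ℕ} {s s' : State V}
    (hs : Step G t s s') : Nat.card (Quotient s'.rel) < Nat.card (Quotient s.rel) := by
  obtain ⟨l, c, e, hc, -, he, rfl⟩ := hs
  have hq := card_quotient_mergeClasses (r := s.rel) (C := Set.range c) ⟨c 0, 0, rfl⟩
  rw [ncard_range_of_dicycle hc] at hq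
  have := hc.1
  simp only
  lia

theorem acc_step {V : Type*} [Finite V] (G : Digraph V) (t : ℕ) (s : State V) :
    Acc (fun s' s => Step G t s s') s :=
  Subrelation.accessible (r := InvImage (· < ·) fun s : State V => Nat.card (Quotient s.rel))
    (fun hs => hs.card_lt) ((InvImage.wf _ wellFounded_lt).apply s)

theorem exists_step {V : Type*} {G : Digraph V} {t : ℕ} {s : State V} {l : ℕ}
    (hl : l ∈ cycleLengths (contract G s.rel)) (hm : MayContract (contract G s.rel) t l) :
    ∃ s', Step G t s s' := by
  obtain ⟨c, hc⟩ := hl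
  choose _ a b ha hb hab using hc.2.2
  exact ⟨_, l, c, fun i => (a i, b i), hc, hm, fun i => ⟨hab i, ha i, hb i⟩, rfl⟩

theorem le_card_of_mem_cycleLengths {W : Type*} [Finite W] {D : Digraph W} {l : ℕ}
    (hl : l ∈ cycleLengths D) : l ≤ Nat.card W := by
  obtain ⟨c, hc⟩ := hl
  rw [← ncard_range_of_dicycle hc, ← Set.ncard_univ]
  exact Set.ncard_le_ncard (Set.subset_univ _)

/-! ### Strong connectivity -/

theorem StronglyConnected.exists_adj_ne {W : Type*} {D : Digraph W} (h : StronglyConnected D)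
    {S : Set W} {u v : W} (hu : u ∈ S) (hv : v ∉ S) : ∃ a ∈ S, ∃ b ∉ S, D.Adj a b := by
  by_contra! hcon
  refine hv ?_
  have := h u v
  clear hv
  induction this with
  | refl => exact hu
  | tail _ hab ih =>
    by_contra hb
    exact hcon _ ih _ hb hab

theorem StronglyConnected.cycleLengths_nonempty {W : Type*} {D : Digraph W}
    (h : StronglyConnected D) {u v : W} (huv : u ≠ v) : ∃ l, l ∈ cycleLengths D := by
  obtain ⟨a, rfl, b, hb, hab⟩ := h.exists_adj_ne (S := {u}) (Set.mem_singleton u) huv.symm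
  obtain ⟨L, hn, hc, hh, hl⟩ := exists_nodup_isChain (h b a)
  refine ⟨L.length, length_mem_cycleLengths hn ?_ hc ?_⟩
  · match L, hh, hl with
    | [x], hh, hl =>
      simp at hh hl
      exact (hb (by rw [← hh, hl]; rfl)).elim
    | x :: y :: L, _, _ => simp
  · intro x y hx hy
    rw [hl] at hx
    rw [hh] at hy
    cases hx
    cases hy
    exact hab

theorem StronglyConnected.contract {V : Type*} {G : Digraph V} (h : StronglyConnected G)
    (r : Setoid V) : StronglyConnected (contract G r) := by
  intro a b
  induction a using Quotient.inductionOn with | _ u =>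
  induction b using Quotient.inductionOn with | _ v =>
  induction h u v with
  | refl => exact .refl
  | @tail x y _ hab ih =>
    by_cases hxy : Quotient.mk r x = Quotient.mk r y
    · rwa [← hxy]
    · exact ih.tail ⟨hxy, x, y, rfl, rfl, hab⟩

/-- Contract arbitrary cycles until one node is left. Applied to an SCSS this bounds its size from
below; applied to the whole digraph it bounds the optimum from above. -/
theorem StronglyConnected.exists_isContraction {V : Type*} [Finite V] [Nonempty V] {G : Digraph V}
    (h : StronglyConnected G) : ∃ s N, IsContraction G s N ∧ Nat.card (Quotient s.rel) = 1 := by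
  suffices H : ∀ s N, IsContraction G s N →
      ∃ s N, IsContraction G s N ∧ Nat.card (Quotient s.rel) = 1 from H _ _ (IsContraction.init G)
  intro s
  induction acc_step G 0 s with
  | intro s _ ih =>
    intro N hs
    have : Nonempty (Quotient s.rel) := Nonempty.map (Quotient.mk s.rel) inferInstance
    by_cases hsub : Subsingleton (Quotient s.rel)
    · exact ⟨s, N, hs, Nat.card_unique⟩
    · obtain ⟨a, b, hab⟩ := not_subsingleton_iff_nontrivial.1 hsub
      obtain ⟨l, hl⟩ := (h.contract s.rel).cycleLengths_nonempty hab
      -- Threshold 0 makes every cycle eligible.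
      obtain ⟨s', hs'⟩ := exists_step (t := 0) hl (Or.inl (Nat.zero_le l))
      exact ih s' hs' _ (hs.step hs')

/-- A strongly connected spanning subgraph of a digraph on `n` nodes whose cycles have length at most
`k` has at least `k * (n - 1) / (k - 1)` arcs. -/
theorem IsSCSS.le_ncard {V : Type*} [Finite V] [Nonempty V] {G : Digraph V} {T : Set (V × V)}
    (hT : IsSCSS G T) {k : ℕ} (hk : ∀ m ∈ cycleLengths G, m ≤ k) :
    k * (Nat.card V - 1) ≤ (k - 1) * T.ncard := by
  obtain ⟨s, N, hs, h1⟩ := hT.2.exists_isContraction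
  have hle : s.arcs.ncard ≤ T.ncard := Set.ncard_le_ncard fun e he => hs.adj e he
  have hk' : ∀ m ∈ cycleLengths (ofArcs T), m ≤ k := by
    rintro m ⟨c, h2, hi, ha⟩
    exact hk m ⟨c, h2, hi, fun i => hT.1 _ (ha i)⟩
  have hc := hs.card
  have hn := hs.le_card k hk'
  rw [h1] at hc hn
  have hpos := Nat.card_pos (α := V)
  obtain ⟨n, hn'⟩ : ∃ n, Nat.card V = n + 1 := ⟨_, (Nat.sub_add_cancel hpos).symm⟩
  rw [hn'] at hc hn ⊢
  rcases k with _ | k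
  · simp
  · simp only [Nat.add_sub_cancel] at *
    -- With `k + 1` now the cycle bound, n ≤ Nk, hence (k + 1)n ≤ k(n + N).
    have : n + N ≤ T.ncard := by lia
    nlinarith

theorem exists_isMinSCSS {W : Type*} [Finite W] {D : Digraph W} (h : StronglyConnected D) :
    ∃ T, IsMinSCSS D T := by
  have hne : {T | IsSCSS D T}.Nonempty := ⟨{e | D.Adj e.1 e.2}, fun e he => he, h⟩
  obtain ⟨T, hT, hmin⟩ := (measure (Set.ncard (α := W × W))).wf.has_min _ hne
  exact ⟨T, hT, fun T' hT' => not_lt.1 (hmin T' hT')⟩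

/-- Contracting down to one of m nodes records m - 1 + N arcs, and N ≤ m - 1. -/
theorem IsMinSCSS.ncard_le {W : Type*} [Finite W] [Nonempty W] {D : Digraph W} {T : Set (W × W)}
    (hT : IsMinSCSS D T) (h : StronglyConnected D) : T.ncard + 2 ≤ 2 * Nat.card W := by
  obtain ⟨s, N, hs, h1⟩ := h.exists_isContraction
  have := (Nat.card_eq_one_iff_unique.1 h1).1
  have hle := hT.2 s.arcs ⟨hs.adj, fun u v => hs.reach u v (Subsingleton.elim _ _)⟩
  have hc := hs.card
  have hl := hs.card_le
  lia

/-! ### A parity theorem on cycles through prescribed nodes -/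

/-- `l` is a simple path, written from its last node to its first one, in the graph of the pairs at which
`κ` does not vanish. It starts with the nodes `x`, `x'` and covers `Γ`. -/
structure IsCoverPath {W : Type*} (κ : W → W → ZMod 2) (Γ : Set W) (x x' : W) (l : List W) :
    Prop where
  nodup : l.Nodup
  chain : l.IsChain fun a b => κ a b ≠ 0
  cover : ∀ v ∈ Γ, v ∈ l
  suffix : [x', x] <:+ l

/-- The lollipop exchange for a path `l` and an edge from its end to `z`. -/
def lollipop {W : Type*} [DecidableEq W] (x : W) (a : List W × W) : List W × W :=
  if a.2 ∉ a.1 then (a.2 :: a.1, a.1.headD x)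
  else if a.1.tail.head? = some a.2 then (a.1.tail, a.1.headD x)
  else ((a.1.takeWhile (· ≠ a.2)).reverse ++ a.1.dropWhile (· ≠ a.2), a.2)

/-- The path `l` and the edge from its end to `z` form a lollipop which can be exchanged. -/
structure IsLollipop {W : Type*} (κ : W → W → ZMod 2) (Γ : Set W) (x x' : W) (a : List W × W) :
    Prop where
  path : IsCoverPath κ Γ x x' a.1
  edge : κ (a.1.headD x) a.2 ≠ 0
  ne : a.2 ≠ x
  not_pred : ¬ (a.1.headD x ∈ Γ ∧ a.1.tail.head? = some a.2)

theorem lollipop_of_notMem {W : Type*} [DecidableEq W] {x z : W} {l : List W} (hz : z ∉ l) :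
    lollipop x (l, z) = (z :: l, l.headD x) := by
  simp [lollipop, hz]

theorem lollipop_cons_cons {W : Type*} [DecidableEq W] {x y z : W} {l : List W} :
    lollipop x (y :: z :: l, z) = (z :: l, y) := by
  simp [lollipop]

theorem lollipop_append {W : Type*} [DecidableEq W] {x z : W} {A B : List W} (hz : z ∉ A)
    (hA : 2 ≤ A.length) :
    lollipop x (A ++ z :: B, z) = (A.reverse ++ z :: B, z) := by
  match A, hA with
  | a :: b :: A, _ =>
    have h1 : ∀ c ∈ a :: b :: A, decide (c ≠ z) = true := by
      intro c hc
      simp only [ne_eq, decide_not, Bool.not_eq_eq_eq_not, Bool.not_true, decide_eq_false_iff_not]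
      rintro rfl
      exact hz hc
    have hb : b ≠ z := by
      rintro rfl
      simp at hz
    have h2 : ((a :: b :: A) ++ z :: B).takeWhile (fun c => decide (c ≠ z)) = a :: b :: A := by
      rw [List.takeWhile_append_of_pos h1]
      simp
    have h3 : ((a :: b :: A) ++ z :: B).dropWhile (fun c => decide (c ≠ z)) = z :: B := by
      rw [List.dropWhile_append_of_pos h1]
      simp
    unfold lollipop
    rw [if_neg (by simp), if_neg (by simpa using hb)]
    simp only [h2, h3]

/-- The three shapes of a lollipop. -/
theorem IsLollipop.cases {W : Type*} {κ : W → W → ZMod 2} {Γ : Set W} {x x' : W} {l : List W} {z : W}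
    (hirr : ∀ a, κ a a = 0) (h : IsLollipop κ Γ x x' (l, z)) :
    z ∉ l ∨ (∃ y B, l = y :: z :: B ∧ y ∉ Γ) ∨
      ∃ A B, l = A ++ z :: B ∧ z ∉ A ∧ 2 ≤ A.length := by
  by_cases hz : z ∈ l
  · right
    obtain ⟨A, B, rfl⟩ := List.append_of_mem hz
    have hzA : z ∉ A := fun hA =>
      (List.nodup_append.1 h.path.nodup).2.2 _ hA _ List.mem_cons_self rfl
    match A, hzA with
    | [], _ => exact (h.edge (hirr z)).elim
    | [y], _ =>
      left
      refine ⟨y, B, rfl, fun hy => h.not_pred ⟨hy, rfl⟩⟩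
    | a :: b :: A, hzA => exact Or.inr ⟨_, B, rfl, hzA, by simp⟩
  · exact Or.inl hz

/-- Appending a node `z` off the path and dropping an end outside `Γ` are inverse to each other: a
node off the path is outside `Γ`, since `Γ` is covered. Otherwise the loop from the end back to `z`
is traversed the other way. No lollipop is fixed: the length changes, or a segment of at least two
distinct nodes is reversed. -/
theorem IsLollipop.exchange {W : Type*} [DecidableEq W] {κ : W → W → ZMod 2} {Γ : Set W} {x x' : W}
    (hsymm : ∀ a b, κ a b = κ b a) (hirr : ∀ a, κ a a = 0) {a : List W × W}
    (h : IsLollipop κ Γ x x' a) :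
    IsLollipop κ Γ x x' (lollipop x a) ∧ lollipop x (lollipop x a) = a ∧ lollipop x a ≠ a := by
  obtain ⟨l, z⟩ := a
  obtain ⟨⟨hn, hc, hcov, hsuf⟩, hedge, hne, hpred⟩ := id h
  have hlen := hsuf.length_le
  simp only [List.length_cons, List.length_nil] at hedge hne hpred hn hc hcov hsuf hlen
  have hlast : l.getLast? = some x := by
    obtain ⟨A, rfl⟩ := hsuf
    simp
  rcases h.cases hirr with hz | ⟨y, B, rfl, hy⟩ | ⟨A, B, rfl, hzA, hA⟩
  · rw [lollipop_of_notMem hz]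
    obtain ⟨y, B, rfl⟩ := List.exists_cons_of_ne_nil (l := l) (by rintro rfl; simp at hlen)
    simp only [List.headD_cons] at hedge ⊢
    refine ⟨⟨⟨?_, ?_, ?_, ?_⟩, ?_, ?_, ?_⟩, ?_, ?_⟩
    · exact List.nodup_cons.2 ⟨hz, hn⟩
    · exact List.isChain_cons_cons.2 ⟨by rwa [hsymm], hc⟩
    · exact fun v hv => List.mem_cons_of_mem _ (hcov v hv)
    · exact hsuf.trans (List.suffix_cons _ _)
    · simpa [hsymm] using hedge
    · rintro rfl
      have hB : B ≠ [] := by rintro rfl; simp at hlen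
      simp only [List.getLast?_cons_of_ne_nil hB] at hlast
      exact (List.nodup_cons.1 hn).1 (List.mem_of_getLast? hlast)
    · exact fun hh => hz (hcov z hh.1)
    · exact lollipop_cons_cons
    · intro hh
      have := congrArg (fun p => p.1.length) hh
      simp at this
  · rw [lollipop_cons_cons]
    have hyB := (List.nodup_cons.1 hn).1
    simp only [List.headD_cons] at hedge
    refine ⟨⟨⟨?_, ?_, ?_, ?_⟩, ?_, ?_, ?_⟩, ?_, ?_⟩
    · exact (List.nodup_cons.1 hn).2
    · exact hc.tail
    · intro v hv
      rcases List.mem_cons.1 (hcov v hv) with rfl | hv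
      · exact (hy ‹_›).elim
      · exact hv
    · rcases List.suffix_cons_iff.1 hsuf with hh | hh
      · simp only [List.cons.injEq] at hh
        exact (hne hh.2.1.symm).elim
      · exact hh
    · simpa [hsymm] using hedge
    · rintro rfl
      simp only [List.getLast?_cons_cons] at hlast
      exact hyB (List.mem_of_getLast? hlast)
    · rintro ⟨-, hh⟩
      exact hyB (List.mem_cons_of_mem _ (List.mem_of_head? hh))
    · exact lollipop_of_notMem hyB
    · intro hh
      have := congrArg (fun p => p.1.length) hh
      simp at this
  · rw [lollipop_append hzA hA]
    have hzA' : z ∉ A.reverse := by simpa using hzA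
    -- As `z ≠ x`, the part `z :: B` left in place has two nodes, so it contains the first edge `x
    -- x'`.
    have hBne : B ≠ [] := by
      rintro rfl
      simp only [List.getLast?_append, List.getLast?_singleton, Option.some_or,
        Option.some.injEq] at hlast
      exact hne hlast
    have hnA := (List.nodup_append.1 hn)
    have hhead : ∀ C : List W, (A.reverse ++ C).headD x = A.getLast (by rintro rfl; simp at hA) := by
      intro C
      rw [← List.head_reverse (by rintro hh; simp at hh; simp [hh] at hA)]
      generalize_proofs hr
      obtain ⟨a, D, hD⟩ := List.exists_cons_of_ne_nil hr
      simp [hD]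
    have hAne : A ≠ [] := by rintro rfl; simp at hA
    obtain ⟨y, A', hA'⟩ := List.exists_cons_of_ne_nil hAne
    refine ⟨⟨⟨?_, ?_, ?_, ?_⟩, ?_, hne, ?_⟩, ?_, ?_⟩
    · refine List.nodup_append.2 ⟨List.nodup_reverse.2 hnA.1, hnA.2.1, ?_⟩
      intro c hcA
      exact hnA.2.2 c (List.mem_reverse.1 hcA)
    · refine List.IsChain.append ?_ hc.right_of_append ?_
      · rw [List.isChain_reverse]
        exact hc.left_of_append.imp fun a b hab => by rwa [hsymm]
      · simp only [List.getLast?_reverse, hA', List.head?_cons, Option.mem_def, Option.some.injEq]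
        rintro _ rfl _ rfl
        simpa [hA'] using hedge
    · intro v hv
      simpa using hcov v hv
    · have h1 : [x', x] <:+ z :: B := by
        refine List.suffix_of_suffix_length_le hsuf (List.suffix_append _ _) ?_
        have := List.length_pos_of_ne_nil hBne
        simp only [List.length_cons, List.length_nil]
        lia
      exact h1.trans (List.suffix_append _ _)
    · simp only [hhead]
      simpa using hc.rel_getLast_head_of_append hAne (by simp : z :: B ≠ [])
    · rintro ⟨-, hh⟩
      refine hzA' ?_
      match hr : A.reverse, hh with
      | [], _ => simp at hr; exact (hAne hr).elim
      | [a], _ =>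
        have := congrArg List.length hr
        simp at this
        lia
      | a :: b :: C, hh =>
        simp only [List.cons_append, List.tail_cons, List.head?_cons, Option.some.injEq] at hh
        simp [hh]
    · rw [lollipop_append hzA' (by simpa using hA)]
      simp
    · intro hh
      have h1 : A.reverse = A := by
        have := congrArg Prod.fst hh
        simpa using this
      have h2 : A.getLast? = A.head? := by rw [← List.head?_reverse, h1]
      rw [hA'] at h2 hnA hA
      have hA'ne : A' ≠ [] := by rintro rfl; simp at hA
      rw [List.getLast?_cons_of_ne_nil hA'ne] at h2
      exact (List.nodup_cons.1 hnA.1).1 (List.mem_of_getLast? h2)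

/-- If the degree of each node of `Γ` other than `x` is odd and the degree of each other node but `x` is
even, then the number of cycles through the edge `x x'` which cover `Γ` is even. Applied to a cycle through
`Γ` and a subgraph of a connected graph in which the parities of the degrees are prescribed, this yields the
second cycle of `SecondHamCycleConjecture`, so that no such hypothesis is needed below. -/
theorem exists_isCoverPath_ne {W : Type*} [Fintype W] {κ : W → W → ZMod 2} {Γ : Set W} {x x' : W}
    (hsymm : ∀ a b, κ a b = κ b a) (hirr : ∀ a, κ a a = 0)
    (hodd : ∀ v ∈ Γ, v ≠ x → ∑ z, κ v z = 1) (heven : ∀ v ∉ Γ, ∑ z, κ v z = 0)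
    (hΓ : ∃ y ∈ Γ, y ≠ x ∧ y ≠ x') {l₀ : List W} (hl₀ : IsCoverPath κ Γ x x' l₀)
    (hcl₀ : κ (l₀.headD x) x ≠ 0) :
    ∃ l, IsCoverPath κ Γ x x' l ∧ κ (l.headD x) x ≠ 0 ∧ l ≠ l₀ := by
  classical
  have hfin : {l | IsCoverPath κ Γ x x' l}.Finite :=
    (List.finite_length_le W (Fintype.card W)).subset fun l hl => hl.nodup.length_le_card
  set S := hfin.toFinset with hS
  have hmem : ∀ l, l ∈ S ↔ IsCoverPath κ Γ x x' l := by simp [hS]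
  -- A third node of `Γ` forces three nodes on the path, so neither its end nor the predecessor of
  -- the end is `x`.
  have hshape : ∀ l, IsCoverPath κ Γ x x' l →
      ∃ y p B, l = y :: p :: B ∧ y ≠ x ∧ p ≠ x ∧ κ y p = 1 := by
    rintro l ⟨hn, hc, hcov, ⟨A, rfl⟩⟩
    obtain ⟨v, hv, hvx, hvx'⟩ := hΓ
    have hnA := List.nodup_append.1 hn
    match A with
    | [] => simpa [hvx, hvx'] using hcov v hv
    | [y] =>
      refine ⟨y, x', [x], rfl, ?_, ?_, ?_⟩
      · exact hnA.2.2 y (by simp) x (by simp)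
      · rintro rfl
        simp at hnA
      · exact (Fin.eq_one_of_ne_zero _ (hc.rel_head? (by simp)))
    | y :: p :: A =>
      refine ⟨y, p, _, rfl, ?_, ?_, ?_⟩
      · exact hnA.2.2 y (by simp) x (by simp)
      · exact hnA.2.2 p (by simp) x (by simp)
      · exact (Fin.eq_one_of_ne_zero _ (hc.rel_head? (by simp)))
  -- Lollipops are paired off by a fixed-point-free involution.
  have hinv : ∑ a ∈ S ×ˢ Finset.univ with IsLollipop κ Γ x x' a, (1 : ZMod 2) = 0 := by
    refine Finset.sum_involution (fun a _ => lollipop x a) ?_ ?_ ?_ ?_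
    · intros; decide
    · intro a ha _
      exact ((Finset.mem_filter.1 ha).2.exchange hsymm hirr).2.2
    · intro a ha
      have := ((Finset.mem_filter.1 ha).2.exchange hsymm hirr).1
      simp only [Finset.mem_filter, Finset.mem_product, hmem, Finset.mem_univ, and_true]
      exact ⟨this.path, this⟩
    · intro a ha
      exact ((Finset.mem_filter.1 ha).2.exchange hsymm hirr).2.1
  rw [Finset.sum_filter, Finset.sum_product] at hinv
  -- The degree of the end `y` is odd exactly when `y ∈ Γ`, which is when its predecessor is
  -- excluded. So an even number of choices of `z` remains, and excluding `x` as well leaves the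
  -- parity `κ y x`.
  have hrow : ∀ l ∈ S, κ (l.headD x) x = ∑ z, if IsLollipop κ Γ x x' (l, z) then (1 : ZMod 2) else 0 := by
    intro l hl
    rw [hmem] at hl
    obtain ⟨y, p, B, rfl, hyx, hpx, hyp⟩ := hshape l hl
    have hz : ∀ z, κ y z = (if IsLollipop κ Γ x x' (y :: p :: B, z) then (1 : ZMod 2) else 0) +
        ((if z = x then κ y x else 0) + if z = p then (if y ∈ Γ then 1 else 0) else 0) := by
      intro z
      have hiff : IsLollipop κ Γ x x' (y :: p :: B, z) ↔ κ y z ≠ 0 ∧ z ≠ x ∧ ¬ (y ∈ Γ ∧ z = p) := by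
        constructor
        · intro h
          exact ⟨h.edge, h.ne, fun hh => h.not_pred ⟨hh.1, by simp [hh.2]⟩⟩
        · rintro ⟨h1, h2, h3⟩
          exact ⟨hl, h1, h2, fun hh => h3 ⟨hh.1, by simpa [eq_comm] using hh.2⟩⟩
      simp only [hiff]
      by_cases hzx : z = x
      · subst hzx
        simp [Ne.symm hpx]
      · by_cases hzp : z = p
        · subst hzp
          by_cases hy : y ∈ Γ <;> simp [hzx, hyp, hy]
        · by_cases h0 : κ y z = 0
          · simp [hzx, hzp, h0]
          · have h1 : κ y z = (1 : ZMod 2) := Fin.eq_one_of_ne_zero _ h0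
            simp [hzx, hzp, h1]
    simp only [List.headD_cons]
    have hsum : ∑ z, κ y z = if y ∈ Γ then 1 else 0 := by
      split_ifs with hy
      · exact hodd y hy hyx
      · exact heven y hy
    rw [Finset.sum_congr rfl fun z _ => hz z, Finset.sum_add_distrib, Finset.sum_add_distrib,
      Finset.sum_ite_eq', Finset.sum_ite_eq', if_pos (Finset.mem_univ _),
      if_pos (Finset.mem_univ _), ← add_assoc, add_eq_right] at hsum
    rw [CharTwo.add_eq_zero] at hsum
    exact hsum.symm
  -- The number of paths that close up to a cycle is even, so `l₀` cannot be the only one.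
  by_contra! hcon
  rw [← Finset.sum_congr rfl hrow, Finset.sum_eq_single l₀] at hinv
  · exact hcl₀ hinv
  · intro l hl hne
    by_contra h0
    exact hne (hcon l ((hmem l).1 hl) h0)
  · intro h
    exact (h ((hmem l₀).2 hl₀)).elim

/-! ### Arcs inside a longest cycle -/

/-- In a connected graph, each set of nodes of even size is the set of the nodes of odd degree of a
subgraph. -/
theorem exists_subgraph_degree_eq {W : Type*} [Fintype W] {r : W → W → Prop}
    (hsymm : ∀ a b, r a b → r b a) (hirr : ∀ a, ¬ r a a) (hconn : ∀ a b, ReflTransGen r a b)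
    {f : W → ZMod 2} (hf : ∑ a, f a = 0) :
    ∃ w : W → W → ZMod 2, (∀ a b, w a b = w b a) ∧ (∀ a b, w a b ≠ 0 → r a b) ∧
      ∀ a, ∑ b, w a b = f a := by
  classical
  rcases isEmpty_or_nonempty W with hW | ⟨⟨x⟩⟩
  · exact ⟨fun _ _ => 0, by simp, by simp, fun a => hW.elim a⟩
  -- Realizable degree vectors form a subspace. It contains the vector of each edge, and by summing
  -- along paths that of each pair `a`, `x`; these span all vectors of sum zero.
  let M : Submodule (ZMod 2) (W → ZMod 2) :=
    { carrier := {f | ∃ w : W → W → ZMod 2, (∀ a b, w a b = w b a) ∧ (∀ a b, w a b ≠ 0 → r a b) ∧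
        ∀ a, ∑ b, w a b = f a}
      zero_mem' := ⟨fun _ _ => 0, by simp, by simp, by simp⟩
      add_mem' := by
        rintro f g ⟨w, h1, h2, h3⟩ ⟨w', h1', h2', h3'⟩
        refine ⟨fun a b => w a b + w' a b, fun a b => ?_, fun a b hab => ?_, fun a => ?_⟩
        · simp only [h1 a, h1' a]
        · by_contra hr
          refine hab ?_
          simp only
          rw [not_imp_comm.1 (h2 a b) hr, not_imp_comm.1 (h2' a b) hr, add_zero]
        · rw [Finset.sum_add_distrib, h3, h3', Pi.add_apply]
      smul_mem' := by
        rintro k f ⟨w, h1, h2, h3⟩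
        refine ⟨fun a b => k * w a b, fun a b => by simp only [h1 a], fun a b hab => ?_, fun a => ?_⟩
        · exact h2 a b (right_ne_zero_of_mul hab)
        · rw [← Finset.mul_sum, h3, Pi.smul_apply, smul_eq_mul] }
  have hedge : ∀ a b, r a b → Pi.single b (1 : ZMod 2) - Pi.single a 1 ∈ M := by
    intro a b hab
    have hne : a ≠ b := by rintro rfl; exact hirr a hab
    refine ⟨fun u v => (if u = a ∧ v = b then 1 else 0) + if u = b ∧ v = a then 1 else 0, ?_, ?_, ?_⟩
    · intro u v
      simp only
      rw [add_comm]
      congr 1 <;> simp only [and_comm]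
    · intro u v huv
      by_cases h1 : u = a ∧ v = b
      · rwa [h1.1, h1.2]
      · by_cases h2 : u = b ∧ v = a
        · rw [h2.1, h2.2]
          exact hsymm _ _ hab
        · simp [h1, h2] at huv
    · intro u
      rw [Finset.sum_add_distrib]
      simp only [ite_and, Finset.sum_ite_irrel, Finset.sum_ite_eq', Finset.mem_univ, if_true,
        Finset.sum_const_zero, Pi.sub_apply, Pi.single_apply]
      rw [CharTwo.sub_eq_add, add_comm]
  have hpath : ∀ a, Pi.single a (1 : ZMod 2) - Pi.single x 1 ∈ M := by
    intro a
    induction hconn x a with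
    | refl => simp
    | @tail b c _ hbc ih =>
      have := M.add_mem (hedge b c hbc) ih
      simpa using this
  have hfM : f = ∑ a, f a • (Pi.single a (1 : ZMod 2) - Pi.single x 1) := by
    simp only [smul_sub, Finset.sum_sub_distrib]
    rw [← Finset.sum_smul, hf, zero_smul, sub_zero]
    funext b
    simp [Finset.sum_apply, Pi.single_apply]
  have : f ∈ M := by
    rw [hfM]
    exact M.sum_mem fun a _ => M.smul_mem _ (hpath a)
  exact this

open Classical in
/-- The number of the edges between `a` and `b` of the undirected cycle `c`, modulo two. -/
noncomputable def cycleEdge {W : Type*} {l : ℕ} [NeZero l] (c : ZMod l → W) (a b : W) : ZMod 2 :=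
  ∑ i, ((if a = c i ∧ b = c (i + 1) then 1 else 0) + if b = c i ∧ a = c (i + 1) then 1 else 0)

/-! ### Degrees of an undirected cycle modulo two. -/

section

variable {W : Type*} {l : ℕ} [NeZero l] {c : ZMod l → W}

theorem cycleEdge_comm (c : ZMod l → W) (a b : W) : cycleEdge c a b = cycleEdge c b a :=
  Finset.sum_congr rfl fun _ _ => add_comm _ _

theorem exists_of_cycleEdge_ne_zero {a b : W} (h : cycleEdge c a b ≠ 0) :
    ∃ i, (a = c i ∧ b = c (i + 1)) ∨ (b = c i ∧ a = c (i + 1)) := by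
  by_contra! hcon
  refine h (Finset.sum_eq_zero fun i _ => ?_)
  rw [if_neg fun h => (hcon i).1 h.1 h.2, if_neg fun h => (hcon i).2 h.1 h.2, add_zero]

/-- Each occurrence of a node is counted once as `c i` and once as `c (i + 1)`. -/
theorem sum_cycleEdge [Fintype W] (c : ZMod l → W) (a : W) : ∑ b, cycleEdge c a b = 0 := by
  classical
  have h : ∀ i, ∑ b, ((if a = c i ∧ b = c (i + 1) then (1 : ZMod 2) else 0) +
      if b = c i ∧ a = c (i + 1) then 1 else 0) =
      (if a = c i then 1 else 0) + if a = c (i + 1) then 1 else 0 := by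
    intro i
    rw [Finset.sum_add_distrib]
    simp only [and_comm (a := _ = c i) (b := a = c (i + 1)), ite_and, Finset.sum_ite_irrel,
      Finset.sum_ite_eq', Finset.mem_univ, if_true, Finset.sum_const_zero]
  have hs := Equiv.sum_comp (Equiv.addRight (1 : ZMod l)) fun i => if a = c i then (1 : ZMod 2) else 0
  simp only [Equiv.coe_addRight] at hs
  calc ∑ b, cycleEdge c a b = ∑ i, ((if a = c i then (1 : ZMod 2) else 0) +
        if a = c (i + 1) then 1 else 0) := by
        simp only [cycleEdge]
        rw [Finset.sum_comm]
        refine Finset.sum_congr rfl fun i _ => ?_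
        convert h i
    _ = 0 := by
        rw [Finset.sum_add_distrib]
        exact (congrArg _ hs).trans (CharTwo.add_self_eq_zero _)

/-- For length 2 the single edge would be counted twice and vanish. -/
theorem cycleEdge_add_one (hc : Function.Injective c) (hl : 3 ≤ l) (i : ZMod l) :
    cycleEdge c (c i) (c (i + 1)) = 1 := by
  have h2 : (2 : ZMod l) ≠ 0 := by
    have : ((2 : ℕ) : ZMod l) ≠ 0 := by
      rw [Ne, ZMod.natCast_eq_zero_iff]
      exact fun h => by have := Nat.le_of_dvd (by lia) h; lia
    exact_mod_cast this
  have h : ∀ j, ¬ (c (i + 1) = c j ∧ c i = c (j + 1)) := by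
    rintro j ⟨h, h'⟩
    have h := hc h
    have h' := hc h'
    exact h2 (by linear_combination h - h')
  unfold cycleEdge
  simp only [h, if_false, add_zero]
  rw [Finset.sum_eq_single i]
  · simp
  · intro j _ hj
    exact if_neg fun hh => hj (hc hh.1).symm
  · simp

end

/-! ### The cycle as a covering path. -/

section

variable {W : Type*} {l : ℕ} [NeZero l] {c : ZMod l → W} {w : W → W → ZMod 2}

theorem isCoverPath_cycle (hc : Function.Injective c) (hl : 3 ≤ l)
    (hw : ∀ i j, w (c i) (c j) = 0) :
    IsCoverPath (fun a b => cycleEdge c a b + w a b) (Set.range c) (c 0) (c 1)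
      ((List.range l).map fun j : ℕ => c j).reverse := by
  refine ⟨?_, ?_, ?_, ?_⟩
  · rw [List.nodup_reverse]
    refine List.Nodup.map_on ?_ List.nodup_range
    intro i hi j hj hij
    exact natCast_zmod_inj_of_lt (List.mem_range.1 hi) (List.mem_range.1 hj) (hc hij)
  · rw [List.isChain_reverse, List.isChain_map, List.isChain_iff_getElem]
    intro i hi
    simp only [List.getElem_range, hw, add_zero]
    push_cast
    rw [cycleEdge_comm, cycleEdge_add_one hc hl]
    exact one_ne_zero
  · rintro _ ⟨i, rfl⟩
    simp only [List.mem_reverse, List.mem_map, List.mem_range]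
    exact ⟨i.val, ZMod.val_lt i, by rw [ZMod.natCast_zmod_val]⟩
  · obtain ⟨m, rfl⟩ : ∃ m, l = m + 2 := ⟨l - 2, by lia⟩
    rw [← List.reverse_prefix, List.reverse_reverse, List.range_succ_eq_map, List.range_succ_eq_map]
    simp

/-- A path through the nodes of a cycle and along its edges is determined by its first two nodes. -/
theorem IsCoverPath.eq_cycle (hc : Function.Injective c)
    (hw : ∀ i j, w (c i) (c j) = 0) {L : List W}
    (hL : IsCoverPath (fun a b => cycleEdge c a b + w a b) (Set.range c) (c 0) (c 1) L)
    (hsub : ∀ v ∈ L, v ∈ Set.range c) (hlen : L.length = l) :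
    L = ((List.range l).map fun j : ℕ => c j).reverse := by
  obtain ⟨R, rfl⟩ : ∃ R : List W, L = R.reverse := ⟨L.reverse, by simp⟩
  obtain ⟨hn, hch, -, hsuf⟩ := hL
  rw [List.nodup_reverse] at hn
  rw [List.isChain_reverse] at hch
  rw [List.length_reverse] at hlen
  have hpre : [c 0, c 1] <+: R := by simpa using List.reverse_prefix.2 hsuf
  simp only [List.mem_reverse] at hsub
  -- The neighbours of `c (j + 1)` along the cycle are `c j`, already visited, and `c (j + 2)`.
  have hpos : ∀ j (hj : j < R.length), R[j] = c j := by
    intro j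
    induction j using Nat.twoStepInduction with
    | zero =>
      intro hj
      obtain ⟨A, rfl⟩ := hpre
      simp
    | one =>
      intro hj
      obtain ⟨A, rfl⟩ := hpre
      simp
    | more j ih0 ih1 =>
      intro hj
      have h := hch.getElem (j + 1) hj
      obtain ⟨i, hi⟩ := hsub _ (List.getElem_mem hj)
      rw [ih1 (by lia)] at h
      rw [← hi, hw, add_zero] at h
      rw [← hi]
      obtain ⟨k, ⟨h1, h2⟩ | ⟨h1, h2⟩⟩ := exists_of_cycleEdge_ne_zero h
      · exfalso
        have h1 := hc h1
        have h2 := hc h2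
        push_cast at h2
        have : R[j + 1 + 1] = R[j] := by
          rw [ih0 (by lia), ← hi]
          congr 1
          linear_combination h1 - h2
        have := (hn.getElem_inj_iff).1 this
        lia
      · congr 1
        have h1 := hc h1
        have h2 := hc h2
        push_cast at h1 ⊢
        linear_combination h2 - h1
  congr 1
  refine List.ext_getElem (by simpa using hlen) ?_
  intro j h1 h2
  simp [hpos j h1]

end

/-- A strongly connected spanning subgraph of a symmetric digraph has at least two arcs with both ends on
any given longest cycle. -/
theorem IsSCSS.two_le_ncard_inter {W : Type*} [Finite W] {D : Digraph W}
    (hsymm : ∀ u v, D.Adj u v → D.Adj v u) {l : ℕ} {c : ZMod l → W} (hc : IsDicycle D l c)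
    (hl : 3 ≤ l) (hmax : ∀ m ∈ cycleLengths D, m ≤ l) {T : Set (W × W)} (hT : IsSCSS D T) :
    2 ≤ (T ∩ Set.range c ×ˢ Set.range c).ncard := by
  classical
  have : NeZero l := ⟨by lia⟩
  have := Fintype.ofFinite W
  set Γ := Set.range c with hΓ
  let B : W → W → Prop := fun a b => a ≠ b ∧ ((a, b) ∈ T ∨ (b, a) ∈ T) ∧ ¬ (a ∈ Γ ∧ b ∈ Γ)
  by_cases hconn : ∀ u v, ReflTransGen B u v
  · exfalso
    have hBsymm : ∀ a b, B a b → B b a := fun a b h =>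
      ⟨h.1.symm, h.2.1.symm, fun hh => h.2.2 hh.symm⟩
    let g : W → ZMod 2 := fun v => if v ∈ Γ then 1 else 0
    -- The value at `c 0` is corrected to make the total zero; the parity theorem does not constrain
    -- the degree there.
    obtain ⟨w, hwsymm, hwB, hwsum⟩ := exists_subgraph_degree_eq (r := B) hBsymm
      (fun a h => h.1 rfl) hconn (f := fun v => g v - if v = c 0 then ∑ u, g u else 0) (by
        rw [Finset.sum_sub_distrib, Finset.sum_ite_eq', if_pos (Finset.mem_univ _), sub_self])
    have hwΓ : ∀ i j, w (c i) (c j) = 0 := by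
      intro i j
      by_contra h
      exact (hwB _ _ h).2.2 ⟨⟨i, rfl⟩, ⟨j, rfl⟩⟩
    have hne : ∀ i : ZMod l, i ≠ i + 1 := by
      have : Fact (1 < l) := ⟨by lia⟩
      simp
    set κ : W → W → ZMod 2 := fun a b => cycleEdge c a b + w a b with hκ
    have hκD : ∀ a b, κ a b ≠ 0 → D.Adj a b := by
      intro a b hab
      by_cases h0 : cycleEdge c a b = 0
      · have h1 : w a b ≠ 0 := by simpa [hκ, h0] using hab
        rcases (hwB _ _ h1).2.1 with h | h
        · exact hT.1 _ h
        · exact hsymm _ _ (hT.1 _ h)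
      · obtain ⟨i, ⟨rfl, rfl⟩ | ⟨rfl, rfl⟩⟩ := exists_of_cycleEdge_ne_zero h0
        · exact hc.2.2 i
        · exact hsymm _ _ (hc.2.2 i)
    have hsumκ : ∀ v, ∑ z, κ v z = g v - if v = c 0 then ∑ u, g u else 0 := by
      intro v
      rw [hκ]
      simp only
      rw [Finset.sum_add_distrib, sum_cycleEdge, hwsum, zero_add]
    have hzero : (((l - 1 : ℕ) : ZMod l)) + 1 = 0 := by
      have : ((l - 1 + 1 : ℕ) : ZMod l) = 0 := by rw [Nat.sub_add_cancel (by lia), ZMod.natCast_self]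
      simpa using this
    obtain ⟨L, hL, hcl, hLne⟩ := exists_isCoverPath_ne (κ := κ) (Γ := Γ) (x := c 0) (x' := c 1)
      (fun a b => by simp only [hκ]; rw [cycleEdge_comm, hwsymm])
      (fun a => by
        by_contra h
        have hcyc : cycleEdge c a a = 0 := by
          by_contra h0
          obtain ⟨i, ⟨h1, h2⟩ | ⟨h1, h2⟩⟩ := exists_of_cycleEdge_ne_zero h0
          · exact hne i (hc.2.1 (h1.symm.trans h2))
          · exact hne i (hc.2.1 (h1.symm.trans h2))
        exact (hwB a a (by simpa [hκ, hcyc] using h)).1 rfl)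
      (fun v hv hvx => by rw [hsumκ, if_neg hvx, sub_zero]; exact if_pos hv)
      (fun v hv => by
        rw [hsumκ, if_neg (by rintro rfl; exact hv ⟨0, rfl⟩), sub_zero]; exact if_neg hv)
      (by
        have h2 : ∀ j : ℕ, j < l → j ≠ 2 → c ((2 : ℕ) : ZMod l) ≠ c j := by
          intro j hj hj2 h
          exact hj2 (natCast_zmod_inj_of_lt (by lia) hj (hc.2.1 h)).symm
        exact ⟨_, ⟨_, rfl⟩, by simpa using h2 0 (by lia) (by lia),
          by simpa using h2 1 (by lia) (by lia)⟩)
      (isCoverPath_cycle hc.2.1 hl hwΓ) (by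
        have : (((List.range l).map fun j : ℕ => c j).reverse).headD (c 0) = c ((l - 1 : ℕ) : ZMod l) := by
          obtain ⟨m, rfl⟩ : ∃ m, l = m + 1 := ⟨l - 1, by lia⟩
          rw [List.range_succ]
          simp
        rw [this]
        have h1 := cycleEdge_add_one hc.2.1 hl ((l - 1 : ℕ) : ZMod l)
        rw [hzero] at h1
        simp only [hκ]
        rw [h1, hwΓ, add_zero]
        exact one_ne_zero)
    have hcard : Γ.ncard = l := ncard_range_of_dicycle hc
    have hLset : {v | v ∈ L}.ncard = L.length := by
      have : {v | v ∈ L} = (L.toFinset : Set W) := by ext; simp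
      rw [this, Set.ncard_coe_finset, List.toFinset_card_of_nodup hL.nodup]
    have hsub : Γ ⊆ {v | v ∈ L} := hL.cover
    have hge : l ≤ L.length := by
      rw [← hcard, ← hLset]
      exact Set.ncard_le_ncard hsub
    -- The second cycle is also a cycle of `D`, so maximality of `l` confines it to `Γ`, where `κ`
    -- has only the edges of `c`.
    have hle : L.length ≤ l := by
      refine hmax _ (length_mem_cycleLengths hL.nodup (by lia) (hL.chain.imp hκD) ?_)
      intro a b ha hb
      obtain ⟨A, rfl⟩ := hL.suffix
      have ha' : c 0 = a := by simpa using ha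
      have hb' : (A ++ [c 1, c 0]).headD (c 0) = b := by simp [List.headD_eq_head?_getD, hb]
      rw [← ha', ← hb']
      exact hsymm _ _ (hκD _ _ hcl)
    have heq : Γ = {v | v ∈ L} := Set.eq_of_subset_of_ncard_le hsub (by rw [hLset, hcard]; exact hle)
    exact hLne (hL.eq_cycle hc.2.1 hwΓ (fun v hv => by rw [← hΓ, heq]; exact hv) (le_antisymm hle hge))
  -- `T` has an arc leaving the component of `u` in `B` and an arc entering it. Neither is an edge
  -- of `B`, so both lie inside `Γ`.
  · push Not at hconn
    obtain ⟨u, v, huv⟩ := hconn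
    have hin : ∀ a b, ReflTransGen B u a → ¬ ReflTransGen B u b → ((a, b) ∈ T ∨ (b, a) ∈ T) →
        a ∈ Γ ∧ b ∈ Γ := by
      intro a b ha hb hab
      by_contra h
      exact hb (ha.tail ⟨by rintro rfl; exact hb ha, hab, h⟩)
    obtain ⟨a, ha, b, hb, hab⟩ := hT.2.exists_adj_ne (S := {a | ReflTransGen B u a})
      (u := u) (v := v) ReflTransGen.refl huv
    obtain ⟨a', ha', b', hb', hab'⟩ := hT.2.exists_adj_ne (S := {a | ¬ ReflTransGen B u a})
      (u := v) (v := u) huv (fun h => h ReflTransGen.refl)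
    have hb'' : ReflTransGen B u b' := not_not.1 hb'
    have h1 := hin a b ha hb (Or.inl hab)
    have h2 := hin b' a' hb'' ha' (Or.inr hab')
    refine (Set.one_lt_ncard).2 ⟨(a, b), ⟨hab, h1.1, h1.2⟩, (a', b'), ⟨hab', h2.2, h2.1⟩, ?_⟩
    intro h
    cases h
    exact ha' ha

/-! ### The approximation ratio -/

/-- The arcs of `T` between different classes of `r`. -/
def outerArcs {V : Type*} (r : Setoid V) (T : Set (V × V)) : Set (V × V) :=
  {e ∈ T | Quotient.mk r e.1 ≠ Quotient.mk r e.2}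

/-- The arc of the contracted digraph represented by `e`. -/
def mkArc {V : Type*} (r : Setoid V) (e : V × V) : Quotient r × Quotient r :=
  (Quotient.mk r e.1, Quotient.mk r e.2)

theorem IsSCSS.contract {V : Type*} {G : Digraph V} {T : Set (V × V)} (hT : IsSCSS G T)
    (r : Setoid V) : IsSCSS (contract G r) (mkArc r '' outerArcs r T) := by
  constructor
  · rintro _ ⟨e, he, rfl⟩
    exact ⟨he.2, e.1, e.2, rfl, rfl, hT.1 e he.1⟩
  · intro a b
    refine ReflTransGen.mono ?_ _ _ (hT.2.contract r a b)
    rintro _ _ ⟨hne, u, v, rfl, rfl, huv⟩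
    exact ⟨(u, v), ⟨huv, hne⟩, rfl⟩

theorem contract_symm {V : Type*} {G : Digraph V} (hsymm : ∀ u v, G.Adj u v → G.Adj v u)
    (r : Setoid V) (a b : Quotient r) (h : (contract G r).Adj a b) : (contract G r).Adj b a := by
  obtain ⟨hne, u, v, hu, hv, huv⟩ := h
  exact ⟨hne.symm, v, u, hv, hu, hsymm u v huv⟩

/-- Each contraction of a longest cycle saves at least two arcs of each spanning subgraph. -/
theorem Reachable.exists_isContraction_ncard {V : Type*} [Finite V] {G : Digraph V} {t k : ℕ}
    (hsymm : ∀ u v, G.Adj u v → G.Adj v u) (hk : ∀ m ∈ cycleLengths G, m ≤ k) (ht : k ≤ t)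
    (hk3 : 3 ≤ k) {s : State V} (h : Reachable G t s) :
    ∃ N, IsContraction G s N ∧
      ∀ T, IsSCSS G T → (outerArcs s.rel T).ncard + 2 * N ≤ T.ncard := by
  induction h with
  | refl =>
    exact ⟨0, IsContraction.init G, fun T _ => Set.ncard_le_ncard fun e he => he.1⟩
  | @tail s s' _ hs ih =>
    obtain ⟨N, hN, hle⟩ := ih
    refine ⟨N + 1, hN.step hs, fun T hT => ?_⟩
    obtain ⟨l, c, e, hc, hm, he, rfl⟩ := hs
    -- Contraction creates no cycle longer than `k`, so a cycle of length at least `t ≥ k` is a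
    -- longest one.
    have hlong : 3 ≤ l ∧ ∀ m ∈ cycleLengths (contract G s.rel), m ≤ l := by
      rcases hm with hm | ⟨-, hm, h4⟩
      · refine ⟨by lia, fun m hmem => ?_⟩
        obtain ⟨m', hm', hmm'⟩ := hN.exists_le_mem_cycleLengths hmem
        have := hk m' hm'
        lia
      · exact ⟨by lia, hm⟩
    have htwo := (hT.contract s.rel).two_le_ncard_inter (contract_symm hsymm s.rel) hc hlong.1 hlong.2
    set r' := mergeClasses s.rel (Set.range c) with hr'
    have hsub : outerArcs r' T ⊆ outerArcs s.rel T := fun a ha =>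
      ⟨ha.1, fun h => ha.2 (mk_mergeClasses_eq_iff.2 (Or.inl h))⟩
    -- Distinct arcs of the contracted digraph have distinct representatives in `T`, and those with
    -- both ends on `c` cease to be outer.
    have hdiff : 2 ≤ (outerArcs s.rel T \ outerArcs r' T).ncard := by
      refine htwo.trans (le_trans (Set.ncard_le_ncard (t := mkArc s.rel '' (outerArcs s.rel T \
        outerArcs r' T)) ?_) (Set.ncard_image_le (Set.toFinite _)))
      rintro _ ⟨⟨a, ha, rfl⟩, h1, h2⟩
      exact ⟨a, ⟨ha, fun h => h.2 (mk_mergeClasses_eq_iff.2 (Or.inr ⟨h1, h2⟩))⟩, rfl⟩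
    have hcard := Set.ncard_sdiff_add_ncard_of_subset hsub
    have := hle T hT
    simp only
    lia

/-- A walk in `T₀` lifts to `T`, with gaps inside classes filled by recorded arcs. -/
theorem Finish.isSCSS {V : Type*} {G : Digraph V} {t N : ℕ} {s : State V}
    {R : Set (V × V)} (hs : IsContraction G s N) (h : Finish G t s R) : IsSCSS G R := by
  obtain ⟨-, T₀, T, hmin, hT, hbij, rfl⟩ := h
  refine ⟨?_, ?_⟩
  · rintro e (he | he)
    · exact hs.adj e he
    · exact hT e he
  · have hin : ∀ u v, Quotient.mk s.rel u = Quotient.mk s.rel v →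
        ReflTransGen (ofArcs (s.arcs ∪ T)).Adj u v := fun u v huv =>
      ReflTransGen.mono (fun a b hab => Or.inl hab) _ _ (hs.reach u v huv)
    have key : ∀ u a, ReflTransGen (ofArcs T₀).Adj (Quotient.mk s.rel u) a →
        ∀ v, Quotient.mk s.rel v = a → ReflTransGen (ofArcs (s.arcs ∪ T)).Adj u v := by
      intro u a hua
      induction hua with
      | refl => exact fun v hv => hin u v hv.symm
      | @tail a b _ hab ih =>
        intro v hv
        obtain ⟨e, he, heab⟩ := hbij.surjOn hab
        simp only [Prod.mk.injEq] at heab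
        exact ((ih e.1 heab.1).tail (Or.inr he)).trans (hin _ _ (heab.2.trans hv.symm))
    exact fun u v => key u _ (hmin.1.2 _ _) v rfl

theorem alwaysHalts {V : Type*} [Finite V] {G : Digraph V} (hconn : StronglyConnected G) (t : ℕ) :
    AlwaysHalts G t := by
  refine ⟨acc_step G t _, fun s _ => ?_⟩
  by_cases hstep : ∃ s', Step G t s s'
  · exact Or.inl hstep
  right
  have hlt : ∀ m ∈ cycleLengths (contract G s.rel), m < t := by
    intro m hm
    by_contra h
    exact hstep (exists_step hm (Or.inl (not_lt.1 h)))
  have hle : ∀ m ∈ cycleLengths (contract G s.rel), m ≤ 3 := by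
    intro m hm
    by_contra h
    -- Cycle lengths are bounded by the number of nodes, so a longest cycle exists and could be
    -- contracted.
    obtain ⟨l, hl, hmax⟩ := ((Set.finite_Iic _).subset fun m hm =>
      le_card_of_mem_cycleLengths hm).exists_maximal (s := cycleLengths (contract G s.rel)) ⟨m, hm⟩
    have hmax' : ∀ m ∈ cycleLengths (contract G s.rel), m ≤ l := fun m hm =>
      (le_total m l).elim id fun h => hmax hm h
    have := hmax' m hm
    exact hstep (exists_step hl (Or.inr ⟨hlt, hmax', by lia⟩))
  obtain ⟨T₀, hT₀⟩ := exists_isMinSCSS (hconn.contract s.rel)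
  have hrep : ∀ a, ∃ e : V × V, a ∈ T₀ → G.Adj e.1 e.2 ∧ mkArc s.rel e = a := by
    intro a
    by_cases ha : a ∉ T₀
    · exact ⟨(a.1.out, a.1.out), fun h => (ha h).elim⟩
    rw [not_not] at ha
    obtain ⟨-, u, v, hu, hv, huv⟩ := hT₀.1.1 a ha
    exact ⟨(u, v), fun _ => ⟨huv, Prod.ext hu hv⟩⟩
  choose f hf using hrep
  refine ⟨s.arcs ∪ f '' T₀, fun m hm => ⟨hlt m hm, hle m hm⟩, T₀, f '' T₀, hT₀, ?_, ?_, rfl⟩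
  · rintro _ ⟨a, ha, rfl⟩
    exact (hf a ha).1
  · refine ⟨?_, ?_, ?_⟩
    · rintro _ ⟨a, ha, rfl⟩
      change mkArc s.rel (f a) ∈ T₀
      rwa [(hf a ha).2]
    · rintro _ ⟨a, ha, rfl⟩ _ ⟨b, hb, rfl⟩ hab
      rw [show a = b from (hf a ha).2.symm.trans (hab.trans (hf b hb).2)]
    · exact fun a ha => ⟨f a, ⟨a, ha, rfl⟩, (hf a ha).2⟩

theorem Finish.two_mul_ncard_le {V : Type*} [Finite V] [Nonempty V] {G : Digraph V} {t k : ℕ}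
    (hsymm : ∀ u v, G.Adj u v → G.Adj v u) (hconn : StronglyConnected G)
    (hk : ∀ m ∈ cycleLengths G, m ≤ k) (hk2 : 2 ≤ k) (ht : k ≤ t) {s : State V}
    (hs : Reachable G t s) {R : Set (V × V)} (hR : Finish G t s R) {T : Set (V × V)}
    (hT : IsSCSS G T) : 2 * R.ncard + 2 ≤ 2 * Nat.card V + T.ncard := by
  obtain ⟨-, T₀, T₁, hmin, -, hbij, rfl⟩ := hR
  have : Nonempty (Quotient s.rel) := Nonempty.map (Quotient.mk s.rel) inferInstance
  have h1 := Set.ncard_union_le s.arcs T₁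
  have h2 : T₁.ncard = T₀.ncard := by rw [← hbij.image_eq, hbij.injOn.ncard_image]
  have h3 := hmin.ncard_le (hconn.contract s.rel)
  -- The saving of two arcs needs cycles of length at least 3. For `k = 2` it is enough that |R| ≤
  -- 2(n - 1) ≤ |T|, with n the number of nodes.
  rcases hk2.eq_or_lt with rfl | hk3
  · obtain ⟨N, hN⟩ := hs.exists_isContraction
    have h4 := hN.card
    have h5 := hN.card_le
    have h6 := hT.le_ncard hk
    have := Nat.card_pos (α := V)
    lia
  · obtain ⟨N, hN, hle⟩ := hs.exists_isContraction_ncard hsymm hk ht hk3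
    have h4 := hN.card
    have h5 := hle T hT
    have h6 := (hmin.2 _ (hT.contract s.rel)).trans (Set.ncard_image_le (Set.toFinite _))
    lia

end SCSS

theorem mainTheorem8 {V : Type*} [Finite V] (G : Digraph V)
    (hsymm : ∀ u v, G.Adj u v → G.Adj v u) (hconn : SCSS.StronglyConnected G)
    (k : ℕ) (hk : IsGreatest (SCSS.cycleLengths G) k)
    (hyp : SCSS.SecondHamCycleConjecture ∨ k < 24)
    (t : ℕ) (ht : k ≤ t) :
    SCSS.AlwaysHalts G t ∧
    ∀ R : Set (V × V), SCSS.IsOutput G t R →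
      SCSS.IsSCSS G R ∧
      ∀ T : Set (V × V), SCSS.IsSCSS G T →
        (R.ncard : ℝ) ≤ (3 * (k : ℝ) - 2) / (2 * (k : ℝ)) * (T.ncard : ℝ) := by
  refine ⟨SCSS.alwaysHalts hconn t, ?_⟩
  rintro R ⟨s, hs, hR⟩
  obtain ⟨N, hN⟩ := hs.exists_isContraction
  refine ⟨hR.isSCSS hN, fun T hT => ?_⟩
  obtain ⟨c, hc⟩ := hk.1
  have : Nonempty V := ⟨c 0⟩
  have h1 := hR.two_mul_ncard_le hsymm hconn (fun m hm => hk.2 hm) hc.1 ht hs hT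
  have h2 := hT.le_ncard (k := k) fun m hm => hk.2 hm
  have hk2 : (2 : ℝ) ≤ k := by exact_mod_cast hc.1
  obtain ⟨n, hn⟩ : ∃ n, Nat.card V = n + 1 := ⟨_, (Nat.sub_add_cancel Nat.card_pos).symm⟩
  obtain ⟨k, rfl⟩ : ∃ k', k = k' + 1 := ⟨k - 1, by have := hc.1; lia⟩
  rw [hn] at h1 h2
  simp only [Nat.add_sub_cancel] at h2
  have h1' : (2 * R.ncard + 2 : ℝ) ≤ 2 * (n + 1) + T.ncard := by exact_mod_cast h1
  have h2' : ((k : ℝ) + 1) * n ≤ k * T.ncard := by exact_mod_cast h2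
  push_cast at hk2 ⊢
  rw [div_mul_eq_mul_div, le_div_iff₀ (by linarith)]
  -- Here `k + 1` is the maximum cycle length and `n + 1` the number of nodes: 2(k + 1)|R| ≤ 2(k +
  -- 1)n + (k + 1)|T| ≤ (3k + 1)|T|.
  nlinarith
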